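/- **Corollary 2.6.** Let $K$ be a compact metric space, $\varphi : K \to K$ a continuous map, and let $S : f \mapsto f\circ\varphi$ be the corresponding Koopman operator on the space $C(K)$ of continuous complex-valued functions on $K$. Assume that there exists a unique $\varphi$-invariant Borel probability measure $\mu$ on $K$. For $\lambda \in \mathbb{T} = \{z \in \mathbb{C} : |z| = 1\}$ let $P_\lambda$ denote the mean ergodic projection of the operator semigroup $\{(\lambda S)^n : n \in \mathbb{N}\}$ on $L^2(K,\mu)$, where $S$ also denotes the Koopman operator on $L^2(K,\mu)$; that is, $P_\lambda$ is the (existing and unique) operator in the closed convex hull $\mathcal{C}_\lambda = \overline{\mathrm{co}}\{(\lambda S)^n : n \in \mathbb{N}\}$ (closure in the strong operator topology) with $P_\lambda U = U P_\lambda = P_\lambda$ for all $U \in \mathcal{C}_\lambda$. If $f \in C(K)$ satisfies $P_\lambda f = 0$ in $L^2(K,\mu)$ for all $\lambda \in \mathbb{T}$, then 1. for every Følner sequence $(F_N)_{N\in\mathbb{N}}$ in $\mathbb{N}$, i.e. every sequence of nonempty finite sets $F_N \subset \mathbb{N}$ with $|(k+F_N)\,\triangle\, F_N| / |F_N| \to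 0$ as $N \to \infty$ for each $k \in \mathbb{N}$, $$\lim_{N\to\infty}\ \sup_{\lambda\in\mathbb{T}}\ \Bigl\| \frac{1}{|F_N|}\sum_{n\in F_N} \lambda^n S^n f \Bigr\|_\infty = 0;$$ 2. for all $0<r<1$ and $\lambda\in\mathbb{T}$ the series $\sum_{n=0}^\infty r^n\lambda^n S^n f$ converges unconditionally in $C(K)$, and $$\lim_{r\uparrow 1}\ \sup_{\lambda\in\mathbb{T}}\ \Bigl\| (1-r)\sum_{n=0}^\infty r^n\lambda^n S^n f \Bigr\|_\infty = 0.$$ -/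

import Mathlib

open MeasureTheory Filter Topology

noncomputable section

/-! ### Mean ergodic operator semigroups -/

section MeanErgodic

variable {X : Type*} [NormedAddCommGroup X] [NormedSpace ℂ X]

/-- The closure of the convex hull of a set `𝒮` of bounded operators on `X` in the strong operator
topology, i.e. the topology that `X →L[ℂ] X` inherits from the product `X → X`, where each factor
`X` carries its norm topology. -/
def strongClosedConvexHull (𝒮 : Set (X →L[ℂ] X)) : Set (X →L[ℂ] X) :=
  {P | (P : X → X) ∈ closure ((fun U : X →L[ℂ] X => (U : X → X)) '' convexHull ℝ 𝒮)}

/-- `P` is a mean ergodic projection of `𝒮`: a zero element of the semigroup `co̅ 𝒮`, where the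
closure of the convex hull is taken in the strong operator topology. -/
structure IsMeanErgodicProjection (𝒮 : Set (X →L[ℂ] X)) (P : X →L[ℂ] X) : Prop where
  mem : P ∈ strongClosedConvexHull 𝒮
  mul_eq : ∀ U ∈ strongClosedConvexHull 𝒮, P * U = P
  eq_mul : ∀ U ∈ strongClosedConvexHull 𝒮, U * P = P

/-- The cyclic semigroup `{T ^ n : n ∈ ℕ}`. -/
def powerSemigroup (T : X →L[ℂ] X) : Set (X →L[ℂ] X) := Set.range fun n : ℕ => T ^ n

theorem IsMeanErgodicProjection.unique {𝒮 : Set (X →L[ℂ] X)} {P Q : X →L[ℂ] X}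
    (hP : IsMeanErgodicProjection 𝒮 P) (hQ : IsMeanErgodicProjection 𝒮 Q) : P = Q := by
  rw [← hP.mul_eq Q hQ.mem, hQ.eq_mul P hP.mem]

/-- For `P` to be a zero element of `co̅ 𝒮` it suffices that `P` lies in it and that
`P S = S P = P` for all `S ∈ 𝒮`. -/
theorem IsMeanErgodicProjection.of_forall_mem {𝒮 : Set (X →L[ℂ] X)} {P : X →L[ℂ] X}
    (hP : P ∈ strongClosedConvexHull 𝒮) (h : ∀ S ∈ 𝒮, P * S = P ∧ S * P = P) :
    IsMeanErgodicProjection 𝒮 P := by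
  have h1 : convexHull ℝ 𝒮 ⊆ {U | P * U = P ∧ U * P = P} := by
    refine convexHull_min h ?_
    intro U hU V hV a b _ _ hab
    have e : (a • P + b • P : X →L[ℂ] X) = P := by rw [← add_smul, hab, one_smul]
    constructor
    · ext x
      have h1 := DFunLike.congr_fun hU.1 x
      have h2 := DFunLike.congr_fun hV.1 x
      have h3 := DFunLike.congr_fun e x
      simp only [mul_apply_eq_comp, add_apply, smul_apply, map_add,
        ContinuousLinearMap.map_smul_of_tower] at h1 h2 h3 ⊢
      rw [h1, h2, h3]
    · ext x
      have h1 := DFunLike.congr_fun hU.2 x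
      have h2 := DFunLike.congr_fun hV.2 x
      have h3 := DFunLike.congr_fun e x
      simp only [mul_apply_eq_comp, add_apply, smul_apply] at h1 h2 h3 ⊢
      rw [h1, h2, h3]
  have h2 : ∀ U ∈ strongClosedConvexHull 𝒮, ∀ x, P (U x) = P x ∧ U (P x) = P x := by
    intro U hU x
    have hcl : IsClosed {g : X → X | P (g x) = P x ∧ g (P x) = P x} :=
      (isClosed_eq (P.continuous.comp (continuous_apply x)) continuous_const).inter
        (isClosed_eq (continuous_apply (P x)) continuous_const)
    refine closure_minimal ?_ hcl hU
    rintro _ ⟨V, hV, rfl⟩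
    exact ⟨DFunLike.congr_fun (h1 hV).1 x, DFunLike.congr_fun (h1 hV).2 x⟩
  exact ⟨hP, fun U hU => ContinuousLinearMap.ext fun x => (h2 U hU x).1,
    fun U hU => ContinuousLinearMap.ext fun x => (h2 U hU x).2⟩

end MeanErgodic

/-- A contraction on a Hilbert space generates a mean ergodic semigroup. -/
theorem existsUnique_isMeanErgodicProjection {H : Type*} [NormedAddCommGroup H]
    [InnerProductSpace ℂ H] [CompleteSpace H] (T : H →L[ℂ] H) (hT : ‖T‖ ≤ 1) :
    ∃! P : H →L[ℂ] H, IsMeanErgodicProjection (powerSemigroup T) P := by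
  set Y := T.eqLocus (1 : H →L[ℂ] H) with hY
  have hlim : ∀ x, Tendsto (birkhoffAverage ℂ T _root_.id · x) atTop (𝓝 (Y.starProjection x)) :=
    fun x => T.tendsto_birkhoffAverage_orthogonalProjection hT x
  have hTP : ∀ x, T (Y.starProjection x) = Y.starProjection x := fun x =>
    (Y.starProjection_apply_mem x : _)
  have hPT : ∀ x, Y.starProjection (T x) = Y.starProjection x := by
    intro x
    have hb : Bornology.IsBounded (Set.range (_root_.id <| T^[·] x)) := by
      refine isBounded_iff_forall_norm_le.2 ⟨‖x‖, ?_⟩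
      rintro _ ⟨n, rfl⟩
      induction n with
      | zero => simp
      | succ n ih =>
        simp only [Function.iterate_succ_apply', _root_.id] at ih ⊢
        exact ((T.le_of_opNorm_le hT _).trans (by simp)).trans ih
    have h0 := tendsto_birkhoffAverage_apply_sub_birkhoffAverage ℂ (f := T) (g := _root_.id)
      (x := x) hb
    exact sub_eq_zero.1 (tendsto_nhds_unique ((hlim (T x)).sub (hlim x)) h0)
  have hpow : ∀ n : ℕ, ∀ x, Y.starProjection ((T ^ n) x) = Y.starProjection x ∧
      (T ^ n) (Y.starProjection x) = Y.starProjection x := by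
    intro n
    induction n with
    | zero => simp
    | succ n ih =>
      intro x
      simp only [pow_succ, mul_apply_eq_comp, hTP, (ih _).2, (ih _).1, hPT, and_self]
  have key : IsMeanErgodicProjection (powerSemigroup T) Y.starProjection := by
    refine IsMeanErgodicProjection.of_forall_mem ?_ ?_
    · refine mem_closure_of_tendsto (f := fun (N : ℕ) x => birkhoffAverage ℂ T _root_.id N x)
        (tendsto_pi_nhds.2 hlim) ?_
      filter_upwards [eventually_gt_atTop 0] with N hN
      refine ⟨∑ n ∈ Finset.range N, (N : ℝ)⁻¹ • T ^ n, ?_, ?_⟩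
      · refine (convex_convexHull ℝ _).sum_mem (fun _ _ => by positivity) ?_
          (fun n _ => subset_convexHull ℝ _ ⟨n, rfl⟩)
        have : (N : ℝ) ≠ 0 := by positivity
        simp [this]
      · funext x
        simp only [birkhoffAverage, birkhoffSum, Finset.smul_sum, sum_apply,
          smul_apply, _root_.id]
        refine Finset.sum_congr rfl fun n _ => ?_
        rw [← Complex.coe_smul, Complex.ofReal_inv, Complex.ofReal_natCast]
        simp
    · rintro _ ⟨n, rfl⟩
      exact ⟨ContinuousLinearMap.ext fun x => (hpow n x).1,
        ContinuousLinearMap.ext fun x => (hpow n x).2⟩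
  exact ⟨Y.starProjection, key, fun Q hQ => hQ.unique key⟩

/-! ### Koopman operators -/

section Koopman

/-- The Koopman operator `f ↦ f ∘ φ` on `C(K)`. -/
def koopman {K : Type*} [TopologicalSpace K] [CompactSpace K] (φ : C(K, K)) : C(K, ℂ) →L[ℂ] C(K, ℂ) where
  toFun f := f.comp φ
  map_add' _ _ := rfl
  map_smul' _ _ := rfl
  cont := ContinuousMap.continuous_precomp φ

variable {K : Type*} [MeasurableSpace K]

/-- The probability measure `μ` is `φ`-invariant and it is the only `φ`-invariant probability
measure on `K`. -/
structure IsUniqueInvariantProbability (φ : K → K) (μ : Measure K) [IsProbabilityMeasure μ] :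
    Prop where
  measurePreserving : MeasurePreserving φ μ μ
  eq_of_invariant : ∀ ν : Measure K, IsProbabilityMeasure ν → MeasurePreserving φ ν ν → ν = μ

/-- The Koopman operator `f ↦ f ∘ φ` on `L²(K, μ)` of a `μ`-preserving map. -/
def koopmanL2 {φ : K → K} {μ : Measure K} (hφ : MeasurePreserving φ μ μ) :
    Lp ℂ 2 μ →L[ℂ] Lp ℂ 2 μ :=
  (Lp.compMeasurePreservingₗᵢ ℂ φ hφ).toContinuousLinearMap

theorem norm_smul_koopmanL2_le {φ : K → K} {μ : Measure K} (hφ : MeasurePreserving φ μ μ)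
    (z : Circle) : ‖(z : ℂ) • koopmanL2 hφ‖ ≤ 1 := by
  rw [norm_smul, Circle.norm_coe, one_mul]
  exact LinearIsometry.norm_toContinuousLinearMap_le _

/-- The mean ergodic projection `P_z` of the semigroup `{(z S) ^ n : n ∈ ℕ}` on `L²(K, μ)`, where
`S` is the Koopman operator. -/
def meanErgodicProjection {φ : K → K} {μ : Measure K} (hφ : MeasurePreserving φ μ μ)
    (z : Circle) : Lp ℂ 2 μ →L[ℂ] Lp ℂ 2 μ :=
  (existsUnique_isMeanErgodicProjection ((z : ℂ) • koopmanL2 hφ)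
    (norm_smul_koopmanL2_le hφ z)).choose

theorem meanErgodicProjection_spec {φ : K → K} {μ : Measure K} (hφ : MeasurePreserving φ μ μ)
    (z : Circle) : IsMeanErgodicProjection (powerSemigroup ((z : ℂ) • koopmanL2 hφ))
      (meanErgodicProjection hφ z) :=
  (existsUnique_isMeanErgodicProjection ((z : ℂ) • koopmanL2 hφ)
    (norm_smul_koopmanL2_le hφ z)).choose_spec.1

end Koopman

/-! ### Følner sequences in `ℕ` -/

/-- `(F N)` is a Følner sequence in the semigroup `(ℕ, +)` (with counting measure): the `F N` are
nonempty finite sets with `|(k + F N) ∆ F N| / |F N| → 0` for all `k ∈ ℕ`. -/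
structure IsFolnerSequence (F : ℕ → Finset ℕ) : Prop where
  nonempty : ∀ N, (F N).Nonempty
  tendsto_zero : ∀ k : ℕ, Tendsto
    (fun N => ((symmDiff ((F N).image (k + ·)) (F N)).card : ℝ) / ((F N).card : ℝ)) atTop (𝓝 0)

end

/-! Cesàro and Abel means are both averages of orbits by probability weights on ℕ that are nearly
shift-invariant, so one estimate serves both: the twisted averages of f are small in sup norm,
uniformly in the twist, once the shift defect δ is small.

Suppose not. Then there are weights w_k with defect tending to 0, twists z_k and points x_k with |∑
w_k(n) z_k^n f(φ^n x_k)| > ε. The probability measures with mass w_k(n) at (φ^n x_k, z_k^n) live on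
the compact space K × 𝕋; let m be a limit, and ζ a limit of the z_k (`exists_limit_measure`). The
K-marginal of m is φ-invariant, hence equals μ by uniqueness. The functional L h = ∫ t h(x) dm is
ζS-invariant and |L h| ≤ ∫ |h| dμ ≤ ‖h‖₂. So L is constant on convex combinations of the (ζS)^n f,
and these approximate P_ζ f = 0 in L²; thus L f = 0 (`eq_zero_of_meanErgodicProjection_eq_zero`),
while |L f| ≥ ε. Uniformity in λ is automatic, since the twist may vary with k. -/

noncomputable section

/-! ### Almost invariant weights on ℕ -/

/-- A probability weight on `ℕ` that is invariant under the shift up to an error `δ`. -/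
structure IsAlmostInvariantWeight (w : ℕ → ℝ) (δ : ℝ) : Prop where
  nonneg : ∀ n, 0 ≤ w n
  hasSum : HasSum w 1
  norm_shift_sub_le : ∀ (u : ℕ → ℂ) (C : ℝ), (∀ n, ‖u n‖ ≤ C) →
    ‖∑' n, (w n : ℂ) * u (n + 1) - ∑' n, (w n : ℂ) * u n‖ ≤ δ * C

namespace IsAlmostInvariantWeight

variable {w : ℕ → ℝ} {δ δ' : ℝ}

theorem mono (h : IsAlmostInvariantWeight w δ) (hδ : δ ≤ δ') : IsAlmostInvariantWeight w δ' where
  nonneg := h.nonneg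
  hasSum := h.hasSum
  norm_shift_sub_le u C hu := (h.norm_shift_sub_le u C hu).trans <|
    mul_le_mul_of_nonneg_right hδ ((norm_nonneg _).trans (hu 0))

/-- The probability measure with mass `w n` at `y n`. -/
def toProbabilityMeasure {Y : Type*} [MeasurableSpace Y]
    (h : IsAlmostInvariantWeight w δ) (y : ℕ → Y) : ProbabilityMeasure Y :=
  ⟨Measure.sum fun n => ENNReal.ofReal (w n) • Measure.dirac (y n), ⟨by
    simp [Measure.sum_apply _ MeasurableSet.univ,
      ← ENNReal.ofReal_tsum_of_nonneg h.nonneg h.hasSum.summable, h.hasSum.tsum_eq]⟩⟩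

theorem integral_toProbabilityMeasure {Y : Type*} [MeasurableSpace Y] [MeasurableSingletonClass Y]
    (h : IsAlmostInvariantWeight w δ) (y : ℕ → Y) (g : Y → ℂ) :
    ∫ p, g p ∂(h.toProbabilityMeasure y : Measure Y) = ∑' n, (w n : ℂ) * g (y n) := by
  change ∫ p, g p ∂(Measure.sum fun n => ENNReal.ofReal (w n) • Measure.dirac (y n)) = _
  rw [integral_sum_dirac fun _ => ENNReal.ofReal_ne_top]
  simp [ENNReal.toReal_ofReal (h.nonneg _)]

end IsAlmostInvariantWeight

/-- Shifting u turns the sum over F into a sum over 1 + F, and the two sums differ only by terms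
indexed by the symmetric difference. -/
theorem isAlmostInvariantWeight_average {F : Finset ℕ} (hF : F.Nonempty) :
    IsAlmostInvariantWeight (fun n => if n ∈ F then (F.card : ℝ)⁻¹ else 0)
      (((symmDiff (F.image (1 + ·)) F).card : ℝ) / F.card) := by
  have hc : (F.card : ℝ) ≠ 0 := by simpa using hF.ne_empty
  refine ⟨fun n => by positivity, ?_, fun u C hu => ?_⟩
  · have hs : ∑ n ∈ F, (if n ∈ F then (F.card : ℝ)⁻¹ else 0) = 1 := by
      rw [Finset.sum_congr rfl fun n hn => if_pos hn]
      simp [hc]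
    exact hs ▸ hasSum_sum_of_ne_finset_zero fun n hn => if_neg hn
  · have key : ∀ v : ℕ → ℂ, ∑' n, ((if n ∈ F then (F.card : ℝ)⁻¹ else 0 : ℝ) : ℂ) * v n =
        (F.card : ℂ)⁻¹ * ∑ n ∈ F, v n := by
      intro v
      rw [tsum_eq_sum (s := F) (fun n hn => by simp [hn]), Finset.mul_sum]
      exact Finset.sum_congr rfl fun n hn => by simp [hn]
    have hshift : ∑ n ∈ F, u (n + 1) = ∑ n ∈ F.image (1 + ·), u n := by
      rw [Finset.sum_image (by simp)]
      simp [add_comm]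
    have hbd : ∀ A : Finset ℕ, ‖∑ n ∈ A, u n‖ ≤ A.card * C := fun A => by
      simpa using norm_sum_le_of_le A fun n _ => hu n
    rw [key (fun n => u (n + 1)), key, ← mul_sub, hshift, ← Finset.sum_sdiff_sub_sum_sdiff,
      norm_mul, div_eq_inv_mul, mul_assoc]
    simp only [norm_inv, Complex.norm_natCast]
    gcongr
    refine (norm_sub_le _ _).trans ((add_le_add (hbd _) (hbd _)).trans_eq ?_)
    rw [symmDiff_def, Finset.sup_eq_union, Finset.card_union_of_disjoint disjoint_sdiff_sdiff]
    push_cast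
    ring

/-- Splitting off the term n = 0 writes the average of u as (1 - r) u 0 + r T, with T the shifted
average. The defect is therefore (1 - r)(T - u 0), and both T and u 0 are bounded by C. -/
theorem isAlmostInvariantWeight_geometric {r : ℝ} (hr : r ∈ Set.Ioo (0 : ℝ) 1) :
    IsAlmostInvariantWeight (fun n => (1 - r) * r ^ n) (2 * (1 - r)) := by
  have h1 : 0 < 1 - r := sub_pos.2 hr.2
  have hsum : HasSum (fun n => (1 - r) * r ^ n) 1 := by
    simpa [h1.ne'] using (hasSum_geometric_of_lt_one hr.1.le hr.2).mul_left (1 - r)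
  refine ⟨fun n => mul_nonneg h1.le (pow_nonneg hr.1.le n), hsum, fun u C hu => ?_⟩
  have hle : ∀ v : ℕ → ℂ, (∀ n, ‖v n‖ ≤ C) → ∀ n,
      ‖(((1 - r) * r ^ n : ℝ) : ℂ) * v n‖ ≤ (1 - r) * r ^ n * C := fun v hv n => by
    rw [norm_mul, Complex.norm_real, Real.norm_of_nonneg (mul_nonneg h1.le (pow_nonneg hr.1.le n))]
    exact mul_le_mul_of_nonneg_left (hv n) (mul_nonneg h1.le (pow_nonneg hr.1.le n))
  have hsummable : ∀ v : ℕ → ℂ, (∀ n, ‖v n‖ ≤ C) →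
      Summable fun n => (((1 - r) * r ^ n : ℝ) : ℂ) * v n := fun v hv =>
    .of_norm_bounded (hsum.summable.mul_right C) (hle v hv)
  have hT : ‖∑' n, (((1 - r) * r ^ n : ℝ) : ℂ) * u (n + 1)‖ ≤ C := by
    simpa using tsum_of_norm_bounded (hsum.mul_right C) (hle _ fun n => hu (n + 1))
  have hsplit : ∑' n, (((1 - r) * r ^ n : ℝ) : ℂ) * u n =
      (1 - r) * u 0 + r * ∑' n, (((1 - r) * r ^ n : ℝ) : ℂ) * u (n + 1) := by
    rw [(hsummable u hu).tsum_eq_zero_add, ← tsum_mul_left]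
    push_cast
    congr 1
    · simp
    · exact tsum_congr fun n => by ring
  rw [hsplit]
  set T := ∑' n, (((1 - r) * r ^ n : ℝ) : ℂ) * u (n + 1)
  calc ‖T - ((1 - r) * u 0 + r * T)‖ = ‖((1 - r : ℝ) : ℂ) * (T - u 0)‖ := by
        congr 1; push_cast; ring
    _ ≤ (1 - r) * (C + C) := by
        rw [norm_mul, Complex.norm_real, Real.norm_of_nonneg h1.le]
        gcongr
        exact (norm_sub_le _ _).trans (add_le_add hT (hu 0))
    _ = 2 * (1 - r) * C := by ring

/-! ### Twisted orbit averages and their limit measures -/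

section Koopman

variable {K : Type*} [MetricSpace K] [CompactSpace K]

theorem koopman_pow_apply (φ : C(K, K)) (n : ℕ) (f : C(K, ℂ)) (x : K) :
    (koopman φ ^ n) f x = f (φ^[n] x) := by
  induction n generalizing f with
  | zero => rfl
  | succ n ih =>
    rw [pow_succ, mul_apply_eq_comp, ih, Function.iterate_succ_apply']
    rfl

theorem norm_koopman_pow_le (φ : C(K, K)) (n : ℕ) (f : C(K, ℂ)) :
    ‖(koopman φ ^ n) f‖ ≤ ‖f‖ :=
  (ContinuousMap.norm_le _ (norm_nonneg f)).2 fun x => by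
    rw [koopman_pow_apply]
    exact f.norm_coe_le_norm _

theorem IsAlmostInvariantWeight.summable_smul_koopman_pow {w : ℕ → ℝ} {δ : ℝ}
    (h : IsAlmostInvariantWeight w δ) (φ : C(K, K)) (z : Circle) (f : C(K, ℂ)) :
    Summable fun n => ((w n : ℂ) * (z : ℂ) ^ n) • (koopman φ ^ n) f := by
  refine .of_norm_bounded (h.hasSum.summable.mul_right ‖f‖) fun n => ?_
  rw [norm_smul, norm_mul, norm_pow, Circle.norm_coe, one_pow, mul_one, Complex.norm_real,
    Real.norm_of_nonneg (h.nonneg n)]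
  exact mul_le_mul_of_nonneg_left (norm_koopman_pow_le φ n f) (h.nonneg n)

theorem IsAlmostInvariantWeight.tsum_smul_koopman_pow_apply {w : ℕ → ℝ} {δ : ℝ}
    (h : IsAlmostInvariantWeight w δ) (φ : C(K, K)) (z : Circle) (f : C(K, ℂ)) (x : K) :
    (∑' n, ((w n : ℂ) * (z : ℂ) ^ n) • (koopman φ ^ n) f) x =
      ∑' n, (w n : ℂ) * ((z : ℂ) ^ n * f (φ^[n] x)) := by
  rw [← ContinuousMap.evalCLM_apply ℂ x,
    (ContinuousMap.evalCLM ℂ x).map_tsum (h.summable_smul_koopman_pow φ z f)]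
  refine tsum_congr fun n => ?_
  rw [ContinuousMap.evalCLM_apply, ContinuousMap.smul_apply, koopman_pow_apply, smul_eq_mul,
    mul_assoc]

variable [MeasurableSpace K] [BorelSpace K]

instance : MeasurableSpace Circle := borel Circle

instance : BorelSpace Circle := ⟨rfl⟩

/-- Along an ultrafilter, twisted orbit averages with asymptotically invariant weights converge to
the functional `h ↦ ∫ t h(x) dm(x, t)` for a probability measure `m` on `K × 𝕋` whose first
marginal is `φ`-invariant. The functional is invariant under `ζ S`, `ζ` a limit of the twists. -/
theorem exists_limit_measure (φ : C(K, K)) {w : ℕ → ℕ → ℝ} {δ : ℕ → ℝ}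
    (hw : ∀ k, IsAlmostInvariantWeight (w k) (δ k)) (hδ : Tendsto δ atTop (𝓝 0))
    (z : ℕ → Circle) (x : ℕ → K) :
    ∃ (m : ProbabilityMeasure (K × Circle)) (ζ : Circle) (l : Ultrafilter ℕ),
      (∀ h : C(K, ℂ), Tendsto (fun k => ∑' n, (w k n : ℂ) * ((z k : ℂ) ^ n * h (φ^[n] (x k)))) l
        (𝓝 (∫ p, (p.2 : ℂ) * h p.1 ∂(m : Measure (K × Circle))))) ∧
      (∀ h : C(K, ℂ), ζ * ∫ p, (p.2 : ℂ) * h (φ p.1) ∂(m : Measure (K × Circle)) =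
        ∫ p, (p.2 : ℂ) * h p.1 ∂(m : Measure (K × Circle))) ∧
      MeasurePreserving φ ((m : Measure (K × Circle)).map Prod.fst)
        ((m : Measure (K × Circle)).map Prod.fst) := by
  -- A free ultrafilter replaces extraction of subsequences: compactness makes the measures and the
  -- twists converge along the same l.
  set l : Ultrafilter ℕ := hyperfilter ℕ
  have hl : (l : Filter ℕ) ≤ atTop := by
    simpa [Nat.cofinite_eq_atTop] using hyperfilter_le_cofinite (α := ℕ)
  -- Recording the power z^n as a second coordinate makes the twisted average the integral of the
  -- continuous function t h(x).
  set y : ℕ → ℕ → K × Circle := fun k n => (φ^[n] (x k), z k ^ n)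
  obtain ⟨m, -, hm⟩ := isCompact_univ.ultrafilter_le_nhds
    (l.map fun k => (hw k).toProbabilityMeasure (y k)) (by simp)
  obtain ⟨ζ, -, hζ⟩ := isCompact_univ.ultrafilter_le_nhds (l.map z) (by simp)
  have hm : Tendsto (fun k => (hw k).toProbabilityMeasure (y k)) l (𝓝 m) := hm
  have hζ : Tendsto z l (𝓝 ζ) := hζ
  have hlim : ∀ g : C(K × Circle, ℂ), Tendsto (fun k => ∑' n, (w k n : ℂ) * g (y k n)) l
      (𝓝 (∫ p, g p ∂(m : Measure (K × Circle)))) := fun g => by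
    have := (ProbabilityMeasure.tendsto_iff_forall_integral_rclike_tendsto ℂ).1 hm
      (BoundedContinuousFunction.mkOfCompact g)
    simpa [IsAlmostInvariantWeight.integral_toProbabilityMeasure] using this
  have hlim' : ∀ h : C(K, ℂ),
      Tendsto (fun k => ∑' n, (w k n : ℂ) * ((z k : ℂ) ^ n * h (φ^[n] (x k)))) l
        (𝓝 (∫ p, (p.2 : ℂ) * h p.1 ∂(m : Measure (K × Circle)))) := fun h => by
    exact hlim ⟨fun p => (p.2 : ℂ) * h p.1, by fun_prop⟩
  have hshift : ∀ (u : ℕ → ℕ → ℂ) (C : ℝ), (∀ k n, ‖u k n‖ ≤ C) → Tendsto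
      (fun k => ∑' n, (w k n : ℂ) * u k (n + 1) - ∑' n, (w k n : ℂ) * u k n) l (𝓝 0) :=
    fun u C hu => squeeze_zero_norm (fun k => (hw k).norm_shift_sub_le (u k) C (hu k))
      (by simpa using (hδ.mono_left hl).mul_const C)
  refine ⟨m, ζ, l, hlim', fun h => ?_, φ.continuous.measurable, ?_⟩
  · have hz : Tendsto (fun k => (z k : ℂ)) l (𝓝 (ζ : ℂ)) :=
      (continuous_subtype_val.tendsto ζ).comp hζ
    -- The shift of z^n h(φ^n x) is z times the twisted orbit of h ∘ φ, so vanishing defect becomes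
    -- ζS-invariance in the limit.
    have h1 := hshift (fun k n => (z k : ℂ) ^ n * h (φ^[n] (x k))) ‖h‖ fun k n => by
      simpa [Circle.norm_coe] using h.norm_coe_le_norm _
    refine sub_eq_zero.1 (tendsto_nhds_unique
      ((hz.mul (hlim' (h.comp φ))).sub (hlim' h)) (h1.congr fun k => ?_))
    rw [← tsum_mul_left]
    congr 1
    refine tsum_congr fun n => ?_
    simp only [Function.iterate_succ_apply', ContinuousMap.comp_apply, pow_succ]
    ring
  · have : IsProbabilityMeasure ((m : Measure (K × Circle)).map Prod.fst) :=
      Measure.isProbabilityMeasure_map measurable_fst.aemeasurable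
    have : IsProbabilityMeasure (((m : Measure (K × Circle)).map Prod.fst).map φ) :=
      Measure.isProbabilityMeasure_map φ.continuous.measurable.aemeasurable
    refine ext_of_forall_integral_eq_of_IsFiniteMeasure fun g => ?_
    have hg := g.continuous
    rw [integral_map φ.continuous.measurable.aemeasurable hg.aestronglyMeasurable,
      integral_map measurable_fst.aemeasurable
        (show Continuous fun x => g (φ x) by fun_prop).aestronglyMeasurable,
      integral_map measurable_fst.aemeasurable hg.aestronglyMeasurable]
    -- Test functions of the first coordinate alone do not see the twist, so the same shift argument
    -- gives plain invariance of the marginal.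
    have h1 := hlim ⟨fun p => (g (φ p.1) : ℂ), by fun_prop⟩
    have h2 := hlim ⟨fun p => (g p.1 : ℂ), by fun_prop⟩
    have h3 := hshift (fun k n => (g (φ^[n] (x k)) : ℂ)) ‖g‖ fun k n => by
      rw [Complex.norm_real]; exact g.norm_coe_le_norm _
    have h4 := tendsto_nhds_unique (h1.sub h2) (h3.congr fun k => by
      simp [y, Function.iterate_succ_apply'])
    simp only [ContinuousMap.coe_mk, integral_complex_ofReal] at h4
    exact_mod_cast sub_eq_zero.1 h4

/-! ### Functionals invariant under a twisted Koopman operator -/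

theorem koopmanL2_toLp (φ : C(K, K)) {μ : Measure K} [IsProbabilityMeasure μ]
    (hφ : MeasurePreserving φ μ μ) (h : C(K, ℂ)) :
    koopmanL2 hφ (ContinuousMap.toLp 2 μ ℂ h) = ContinuousMap.toLp 2 μ ℂ (koopman φ h) :=
  rfl

/-- If `P_z f = 0`, then `f` is annihilated by every `L¹`-bounded functional on `C(K)` that is
invariant under `z S`. -/
theorem eq_zero_of_meanErgodicProjection_eq_zero (φ : C(K, K)) {μ : Measure K}
    [IsProbabilityMeasure μ] (hφ : MeasurePreserving φ μ μ) (z : Circle) {f : C(K, ℂ)}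
    (hf : meanErgodicProjection hφ z (ContinuousMap.toLp 2 μ ℂ f) = 0)
    (L : C(K, ℂ) →ₗ[ℂ] ℂ) (hL : ∀ h, L ((z : ℂ) • koopman φ h) = L h)
    (hbd : ∀ h, ‖L h‖ ≤ ∫ x, ‖h x‖ ∂μ) : L f = 0 := by
  set T := (z : ℂ) • koopmanL2 hφ
  set g := ContinuousMap.toLp 2 μ ℂ f
  have hL2 : ∀ h : C(K, ℂ), ‖L h‖ ≤ ‖ContinuousMap.toLp 2 μ ℂ h‖ := fun h => by
    have hae := ContinuousMap.coeFn_toLp (p := 2) μ (𝕜 := ℂ) h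
    refine (hbd h).trans ?_
    rw [integral_norm_eq_lintegral_enorm h.continuous.aestronglyMeasurable,
      ← eLpNorm_one_eq_lintegral_enorm, Lp.norm_def, eLpNorm_congr_ae hae]
    refine ENNReal.toReal_mono ?_ (eLpNorm_le_eLpNorm_of_exponent_le one_le_two
      h.continuous.aestronglyMeasurable)
    rw [← eLpNorm_congr_ae hae]
    exact Lp.eLpNorm_ne_top _
  -- L is only defined on C(K), so rather than extending it to L² one carries a continuous
  -- representative of U g on which L still takes the value L f.
  have hrep : ∀ U ∈ convexHull ℝ (powerSemigroup T),
      ∃ h : C(K, ℂ), ContinuousMap.toLp 2 μ ℂ h = U g ∧ L h = L f := by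
    refine convexHull_min (t := {U : Lp ℂ 2 μ →L[ℂ] Lp ℂ 2 μ |
      ∃ h : C(K, ℂ), ContinuousMap.toLp 2 μ ℂ h = U g ∧ L h = L f}) ?_ ?_
    · rintro _ ⟨n, rfl⟩
      induction n with
      | zero => exact ⟨f, rfl, rfl⟩
      | succ n ih =>
        obtain ⟨h, h1, h2⟩ := ih
        refine ⟨(z : ℂ) • koopman φ h, ?_, (hL h).trans h2⟩
        simp only [pow_succ', mul_apply_eq_comp] at h1 ⊢
        rw [← h1, map_smul, ← koopmanL2_toLp φ hφ]
        rfl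
    · rintro U ⟨h, h1, h2⟩ V ⟨h', h1', h2'⟩ a b _ _ hab
      refine ⟨(a : ℂ) • h + (b : ℂ) • h', ?_, ?_⟩
      · simp [h1, h1']
      · rw [map_add, map_smul, map_smul, h2, h2', ← add_smul]
        norm_cast
        simp [hab]
  have hcl : ‖L f‖ ≤ ‖meanErgodicProjection hφ z g‖ := by
    -- The bound |L f| ≤ ‖V g‖ depends on V only through its value at g, hence survives strong
    -- limits and reaches P_z.
    have hclosed : IsClosed {V : Lp ℂ 2 μ → Lp ℂ 2 μ | ‖L f‖ ≤ ‖V g‖} :=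
      isClosed_le continuous_const (continuous_apply g).norm
    refine closure_minimal ?_ hclosed (meanErgodicProjection_spec hφ z).mem
    rintro _ ⟨U, hU, rfl⟩
    obtain ⟨h, h1, h2⟩ := hrep U hU
    change ‖L f‖ ≤ ‖U g‖
    rw [← h1, ← h2]
    exact hL2 h
  rw [hf, norm_zero] at hcl
  exact norm_le_zero_iff.1 hcl

/-! ### Uniform estimate and conclusion -/

/-- A uniform Wiener–Wintner estimate for almost invariant weights. -/
theorem exists_forall_isAlmostInvariantWeight_norm_le (φ : C(K, K)) (μ : Measure K)
    [IsProbabilityMeasure μ] (hμ : IsUniqueInvariantProbability φ μ) (f : C(K, ℂ))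
    (hf : ∀ z : Circle,
      meanErgodicProjection hμ.measurePreserving z (ContinuousMap.toLp 2 μ ℂ f) = 0)
    {ε : ℝ} (hε : 0 < ε) :
    ∃ δ > 0, ∀ w, IsAlmostInvariantWeight w δ → ∀ z : Circle,
      ‖∑' n, ((w n : ℂ) * (z : ℂ) ^ n) • (koopman φ ^ n) f‖ ≤ ε := by
  by_contra! hcon
  choose w hw z hz using fun k : ℕ => hcon (1 / (k + 1 : ℝ)) (by positivity)
  have hx : ∀ k, ∃ x, ε < ‖∑' n, (w k n : ℂ) * ((z k : ℂ) ^ n * f (φ^[n] x))‖ := fun k => by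
    by_contra! hle
    refine (hz k).not_ge ((ContinuousMap.norm_le _ hε.le).2 fun x => ?_)
    rw [(hw k).tsum_smul_koopman_pow_apply]
    exact hle x
  choose x hx using hx
  obtain ⟨m, ζ, l, hlim, hinv, hpres⟩ := exists_limit_measure φ hw
    tendsto_one_div_add_atTop_nhds_zero_nat z x
  have hmap : (m : Measure (K × Circle)).map Prod.fst = μ :=
    hμ.eq_of_invariant _ (Measure.isProbabilityMeasure_map measurable_fst.aemeasurable) hpres
  have hint : ∀ h : C(K, ℂ),
      Integrable (fun p : K × Circle => (p.2 : ℂ) * h p.1) (m : Measure (K × Circle)) := fun h =>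
    (show Continuous fun p : K × Circle => (p.2 : ℂ) * h p.1 by
      fun_prop).integrable_of_hasCompactSupport (HasCompactSupport.of_compactSpace _)
  let L : C(K, ℂ) →ₗ[ℂ] ℂ :=
    { toFun := fun h => ∫ p, (p.2 : ℂ) * h p.1 ∂(m : Measure (K × Circle))
      map_add' := fun h h' => by
        simp only [ContinuousMap.add_apply, mul_add]
        exact integral_add (hint h) (hint h')
      map_smul' := fun c h => by
        simp only [ContinuousMap.smul_apply, smul_eq_mul, mul_left_comm, RingHom.id_apply]
        exact integral_const_mul _ _ }
  have hL0 : L f = 0 := by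
    refine eq_zero_of_meanErgodicProjection_eq_zero φ hμ.measurePreserving ζ (hf ζ) L
      (fun h => ?_) fun h => ?_
    · rw [map_smul]
      exact hinv h
    · refine (norm_integral_le_integral_norm _).trans_eq ?_
      rw [← hmap, integral_map measurable_fst.aemeasurable
        h.continuous.norm.aestronglyMeasurable]
      simp [Circle.norm_coe]
  have hge : ε ≤ ‖L f‖ := ge_of_tendsto' (hlim f).norm fun k => (hx k).le
  rw [hL0, norm_zero] at hge
  exact hge.not_gt hε

/-- The weights need only be almost invariant eventually, because the Abel weights are probability
weights only for r near 1 from below. -/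
theorem tendsto_iSup_enorm_tsum_smul_koopman_pow (φ : C(K, K)) (μ : Measure K)
    [IsProbabilityMeasure μ] (hμ : IsUniqueInvariantProbability φ μ) (f : C(K, ℂ))
    (hf : ∀ z : Circle,
      meanErgodicProjection hμ.measurePreserving z (ContinuousMap.toLp 2 μ ℂ f) = 0)
    {ι : Type*} {l : Filter ι} {w : ι → ℕ → ℝ} {δ : ι → ℝ}
    (hw : ∀ᶠ i in l, IsAlmostInvariantWeight (w i) (δ i)) (hδ : Tendsto δ l (𝓝 0)) :
    Tendsto (fun i => ⨆ z : Circle,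
      ‖∑' n, ((w i n : ℂ) * (z : ℂ) ^ n) • (koopman φ ^ n) f‖ₑ) l (𝓝 0) := by
  refine ENNReal.tendsto_nhds_zero.2 fun ε hε => ?_
  obtain ⟨ε', hε', hle⟩ : ∃ ε' : ℝ, 0 < ε' ∧ ENNReal.ofReal ε' ≤ ε := by
    obtain ⟨r, -, hr0, hr⟩ := ENNReal.lt_iff_exists_real_btwn.1 hε
    exact ⟨r, ENNReal.ofReal_pos.1 hr0, hr.le⟩
  obtain ⟨δ', hδ', h⟩ := exists_forall_isAlmostInvariantWeight_norm_le φ μ hμ f hf hε'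
  filter_upwards [hw, hδ.eventually_le_const hδ'] with i hi hi'
  refine (iSup_le fun z => ?_).trans hle
  rw [← ofReal_norm]
  exact ENNReal.ofReal_le_ofReal (h _ (hi.mono hi') z)

end Koopman

end

theorem corollary2p6 {K : Type*} [MetricSpace K] [CompactSpace K] [MeasurableSpace K]
    [BorelSpace K] (φ : C(K, K)) (μ : Measure K) [IsProbabilityMeasure μ]
    (hμ : IsUniqueInvariantProbability φ μ) (f : C(K, ℂ))
    (hf : ∀ z : Circle,
      meanErgodicProjection hμ.measurePreserving z (ContinuousMap.toLp 2 μ ℂ f) = 0) :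
    (∀ F : ℕ → Finset ℕ, IsFolnerSequence F →
      Tendsto (fun N : ℕ => ⨆ z : Circle,
        ‖((F N).card : ℂ)⁻¹ • ∑ n ∈ F N, (z : ℂ) ^ n • (koopman φ ^ n) f‖ₑ) atTop (𝓝 0)) ∧
    (∀ r ∈ Set.Ioo (0 : ℝ) 1, ∀ z : Circle,
      Summable fun n : ℕ => ((r : ℂ) ^ n * (z : ℂ) ^ n) • (koopman φ ^ n) f) ∧
    Tendsto (fun r : ℝ => ⨆ z : Circle,
      ‖(1 - r : ℂ) • ∑' n : ℕ, ((r : ℂ) ^ n * (z : ℂ) ^ n) • (koopman φ ^ n) f‖ₑ)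
      (𝓝[<] 1) (𝓝 0) := by

  refine ⟨fun F hF => ?_, fun r hr z => ?_, ?_⟩
  · refine (tendsto_iSup_enorm_tsum_smul_koopman_pow φ μ hμ f hf
      (.of_forall fun N => isAlmostInvariantWeight_average (hF.nonempty N))
      -- Only the translation by k = 1 is needed.
      (hF.tendsto_zero 1)).congr fun N => iSup_congr fun z => ?_
    rw [tsum_eq_sum (s := F N) (fun n hn => by simp [hn]), Finset.smul_sum]
    congr 1
    refine Finset.sum_congr rfl fun n hn => ?_
    simp [hn, mul_smul]
  · have h1 : (1 - r : ℂ) ≠ 0 := by exact_mod_cast (sub_pos.2 hr.2).ne'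
    refine (((isAlmostInvariantWeight_geometric hr).summable_smul_koopman_pow φ z f).const_smul
      (1 - r : ℂ)⁻¹).congr fun n => ?_
    rw [smul_smul]
    congr 1
    push_cast
    field_simp
  · have hev : ∀ᶠ r in 𝓝[<] (1 : ℝ), r ∈ Set.Ioo (0 : ℝ) 1 := Ioo_mem_nhdsLT one_pos
    have hδ : Tendsto (fun r : ℝ => 2 * (1 - r)) (𝓝[<] 1) (𝓝 0) :=
      (Continuous.tendsto' (by fun_prop) 1 0 (by simp)).mono_left nhdsWithin_le_nhds
    refine (tendsto_iSup_enorm_tsum_smul_koopman_pow φ μ hμ f hf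
      (hev.mono fun r hr => isAlmostInvariantWeight_geometric hr) hδ).congr fun r =>
        iSup_congr fun z => ?_
    -- The identity is required for every real r, including those where the series may diverge; this
    -- form of scalar extraction needs no summability.
    rw [← tsum_const_smul'']
    congr 2 with n
    simp [smul_smul, mul_assoc]
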